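/- Let $\overline{\mathbb Q}\subset\mathbb C$ be the field of algebraic numbers. For $a,b,d\in\overline{\mathbb Q}$ put $V=\begin{pmatrix}a&b\\-b&d\end{pmatrix}$, $L_S=\operatorname{diag}(1,-1)$, and consider the pencil $A(u;\lambda)=u^2I-L_S-\lambda u^{-1}V$ (with $u=z^{1/2}$, $u\neq0$). Put $\tau=a+d$, $\delta=a-d$, $\Delta=ad+b^2$, $\mu=-b^2$. The pencil is smooth if $\Delta\,\mu\,(\tau^2-4\Delta)(\delta^2+4\Delta)\ne0$, and the $j$-moduli map sends a smooth pencil to $$j(\tau,\delta,\Delta,\mu)=\frac{16(\tau^2\delta^2+12\Delta\mu)^3}{\Delta^2\mu^2(\tau^2-4\Delta)(\delta^2+4\Delta)}.$$ The spectral curve is the plane curve $P(u,\lambda)=u^2\det A(u;\lambda)=0$. For numbers $t$ and $q\ne0$ the master quadratic is $\mathcal A Y^2+\mathcal B Y+\mathcal C=0$ with $\mathcal A=\tau^2-4\Delta$, $\mathcal B=-\frac{t\mathcal A}{q}+2\delta\tau$, $\mathcal C=\tau^2-\frac{t\delta\tau}{q}-\frac{\Delta t^2}{q^2}+\frac{\tau^2}{q}$.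 The pencil is $J$-self-adjoint, for $J=\operatorname{diag}(1,-1)$, if $JA(u;\lambda)^\dagger J=A(u;\lambda)$ for all real $\lambda$ and $u\ne0$, that is, if $a,b,d$ are real. Theorem. (1) The image of the $j$-moduli map on the smooth pencils over $\overline{\mathbb Q}$ is Zariski-dense in $\mathbb P^1_{\overline{\mathbb Q}}$. (2) Let $E$ be an elliptic curve over $\overline{\mathbb Q}$ whose $j$-invariant lies in this image. Then there is a smooth pencil over $\overline{\mathbb Q}$, with $j(\tau,\delta,\Delta,\mu)=j(E)$, such that: (a) $P$ is irreducible and the smooth projective model of the spectral curve $P=0$ is isomorphic to $E$ over $\overline{\mathbb Q}$ (equivalently, their function fields are isomorphic over $\overline{\mathbb Q}$); (b) for every number field $K\hookrightarrow\overline{\mathbb Q}$, every model $E_0/K$ of $E$ and every prime $v$ of $K$ at which $E_0$ has good reduction, with $q=\#k_v$ and $t=a_v=q+1-\#\tilde E_0(k_v)$: one has $\tau\ne0$ and $\mathcal A\neq 0$, the master quadratic has a nonzero root in $\mathbb C$, and for every $u\in\mathbb C^\times$ such that $u^2$ is a root, with $\lambda=\frac{2u^3}{\tau}-\frac{a_vu}{q\tau}$,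 the matrix $A(u;\lambda)$ is invertible and its inverse $R$ satisfies, for all $s\in\mathbb C$, $$\det(I-q^{-s}R)=1-a_vq^{-s}+q^{1-2s},$$ the Hasse–Weil Euler factor of $E_0$ at $v$. (For $K=\mathbb Q$ this is the factor $1-a_pp^{-s}+p^{1-2s}$ at every good prime $p$.) (3) Statements (1) and (2) also hold with "pencil over $\overline{\mathbb Q}$" replaced throughout by "$J$-self-adjoint pencil over $\overline{\mathbb Q}$", both in the domain of the $j$-moduli map and in the conclusion. -/

import Mathlib

open scoped Matrix Polynomial LinearAlgebra.Projectivization NumberField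
open IsDedekindDomain

noncomputable section

/-- The field of algebraic numbers, as a subfield of `ℂ`. -/
abbrev QBar : Type := algebraicClosure ℚ ℂ

/-- The `2 × 2` pencil `u² - L_S - λ u⁻¹ V` with `L_S = diag(1, -1)` and coupling matrix
`V = (a, b; -b, d)`, recorded through the entries of `V`. The variable `u` is `z^{1/2}`, so that
`u⁻¹` is the causal kernel `z^{-1/2}`. -/
structure CausalPencil (F : Type*) where
  a : F
  b : F
  d : F

namespace CausalPencil

variable {F : Type*} [Field F]

/-- The system operator `diag(1, -1)`, over any commutative ring. -/
def systemOp (R : Type*) [CommRing R] : Matrix (Fin 2) (Fin 2) R := !![1, 0; 0, -1]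

/-- The fundamental symmetry `J = diag(1, -1)`. -/
def fundSymm (R : Type*) [CommRing R] : Matrix (Fin 2) (Fin 2) R := !![1, 0; 0, -1]

/-- The coupling matrix `V`. -/
def coupling (V : CausalPencil F) : Matrix (Fin 2) (Fin 2) F := !![V.a, V.b; -V.b, V.d]

/-- The pencil `A(u; λ) = u² - L_S - λ u⁻¹ V` (meaningful for `u ≠ 0`). -/
def pencil (V : CausalPencil F) (u l : F) : Matrix (Fin 2) (Fin 2) F :=
  u ^ 2 • (1 : Matrix (Fin 2) (Fin 2) F) - systemOp F - (l * u⁻¹) • V.coupling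

/-- `τ = tr V`. -/
def tau (V : CausalPencil F) : F := V.a + V.d

/-- `δ = a - d`. -/
def delta (V : CausalPencil F) : F := V.a - V.d

/-- `Δ = det V`. -/
def Delta (V : CausalPencil F) : F := V.a * V.d + V.b ^ 2

/-- `μ = v₁₂ v₂₁`. -/
def mu (V : CausalPencil F) : F := -V.b ^ 2

/-- The smooth parameter locus: the denominator of the `j`-moduli map does not vanish. -/
def IsSmooth (V : CausalPencil F) : Prop :=
  V.Delta ^ 2 * V.mu ^ 2 * (V.tau ^ 2 - 4 * V.Delta) * (V.delta ^ 2 + 4 * V.Delta) ≠ 0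

/-- The `j`-moduli map `(τ, δ, Δ, μ) ↦ j` (meaningful on the smooth locus). -/
def jMap (V : CausalPencil F) : F :=
  16 * (V.tau ^ 2 * V.delta ^ 2 + 12 * V.Delta * V.mu) ^ 3 /
    (V.Delta ^ 2 * V.mu ^ 2 * (V.tau ^ 2 - 4 * V.Delta) * (V.delta ^ 2 + 4 * V.Delta))

/-- The spectral polynomial `P(u, λ) = u² det A(u; λ) = det (u A(u; λ))`, an element of
`F[u][λ]`. -/
def spectralPoly (V : CausalPencil F) : F[X][X] :=
  let u : F[X][X] := Polynomial.C Polynomial.X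
  let l : F[X][X] := Polynomial.X
  (u ^ 3 • (1 : Matrix (Fin 2) (Fin 2) F[X][X]) - u • systemOp F[X][X]
    - l • V.coupling.map (fun x => Polynomial.C (Polynomial.C x))).det

/-- The spectral curve `P(u, λ) = 0` is an integral curve whose smooth projective model is
isomorphic over `F` to the elliptic curve `E`. The plane curve `P = 0` itself is singular and not
complete; two smooth projective curves over `F` are isomorphic over `F` exactly if their function
fields are isomorphic over `F`, and this is how the isomorphism is expressed. -/
def SpectralCurveIso (V : CausalPencil F) (E : WeierstrassCurve F) : Prop :=
  Irreducible V.spectralPoly ∧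
    Nonempty (FractionRing (AdjoinRoot V.spectralPoly) ≃ₐ[F] E.toAffine.FunctionField)

/-- The leading coefficient of the master quadratic. -/
def masterA (V : CausalPencil F) : F := V.tau ^ 2 - 4 * V.Delta

/-- The middle coefficient of the master quadratic for the trace `t` and the norm `q`. -/
def masterB (V : CausalPencil F) (t q : F) : F :=
  -(t * V.masterA / q) + 2 * V.delta * V.tau

/-- The constant coefficient of the master quadratic for the trace `t` and the norm `q`. -/
def masterC (V : CausalPencil F) (t q : F) : F :=
  V.tau ^ 2 - t * V.delta * V.tau / q - V.Delta * t ^ 2 / q ^ 2 + V.tau ^ 2 / q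

/-- `Y` is a root of the master quadratic. -/
def IsMasterRoot (V : CausalPencil F) (t q Y : F) : Prop :=
  V.masterA * Y ^ 2 + V.masterB t q * Y + V.masterC t q = 0

/-- The second coordinate `λ = 2u³/τ - t u/(q τ)` of the basepoint with first coordinate `u`. -/
def basepointLambda (V : CausalPencil F) (t q u : F) : F :=
  2 * u ^ 3 / V.tau - t * u / (q * V.tau)

/-- The pencil over `ℂ` given by a pencil with algebraic entries. -/
def toComplex (V : CausalPencil QBar) : CausalPencil ℂ := ⟨V.a, V.b, V.d⟩

/-- `J`-self-adjointness `J A† J = A` of the pencil at all real `(u, λ)`, `u ≠ 0`; for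
`V = (a, b; -b, d)` this says that `a, b, d` are real. -/
def IsJSelfAdjoint (V : CausalPencil QBar) : Prop :=
  ∀ u l : ℝ, u ≠ 0 →
    fundSymm ℂ * (V.toComplex.pencil (u : ℂ) (l : ℂ))ᴴ * fundSymm ℂ =
      V.toComplex.pencil (u : ℂ) (l : ℂ)

end CausalPencil

/-- The Zariski topology on the closed points of the projective line over `F`: the open sets are
the unions of the complements of zero loci of homogeneous polynomials. -/
@[reducible] def zariskiTopology (F : Type*) [Field F] : TopologicalSpace (ℙ F (Fin 2 → F)) :=
  TopologicalSpace.generateFrom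
    {U | ∃ (n : ℕ) (f : MvPolynomial (Fin 2) F), f.IsHomogeneous n ∧
      U = {x | MvPolynomial.eval x.rep f ≠ 0}}

/-- Zariski density in the projective line. -/
def ZariskiDense {F : Type*} [Field F] (S : Set (ℙ F (Fin 2 → F))) : Prop :=
  @Dense _ (zariskiTopology F) S

/-- The point `[t : 1]` of the projective line. -/
def affinePoint {F : Type*} [Field F] (t : F) : ℙ F (Fin 2 → F) :=
  Projectivization.mk F ![t, 1] (fun h => one_ne_zero (congrFun h 1))

/-- The image in the projective `j`-line of the smooth pencils in `S` under the `j`-moduli map. -/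
def jImage {F : Type*} [Field F] (S : Set (CausalPencil F)) : Set (ℙ F (Fin 2 → F)) :=
  {x | ∃ V ∈ S, V.IsSmooth ∧ x = affinePoint V.jMap}

section Arithmetic

variable {K : Type} [Field K] [NumberField K]

/-- The completion of `W` at the prime `v` has good reduction. -/
def GoodPrime (W : WeierstrassCurve K) (v : HeightOneSpectrum (𝓞 K)) : Prop :=
  ((W.baseChange (v.adicCompletion K)).minimal (v.adicCompletionIntegers K)).HasGoodReduction
    (v.adicCompletionIntegers K)

/-- The cardinality `q` of the residue field at `v`. -/
def primeNorm (v : HeightOneSpectrum (𝓞 K)) : ℕ :=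
  Nat.card (IsLocalRing.ResidueField (v.adicCompletionIntegers K))

/-- The trace of Frobenius `q + 1 - #W̃(k_v)` at a prime of good reduction. -/
def frobTrace (W : WeierstrassCurve K) (v : HeightOneSpectrum (𝓞 K)) : ℤ :=
  (primeNorm v : ℤ) + 1 -
    Nat.card (((W.baseChange (v.adicCompletion K)).minimal
      (v.adicCompletionIntegers K)).reduction (v.adicCompletionIntegers K)).toAffine.Point

/-- The Hasse–Weil Euler factor of `W` at `v`, that is the local polynomial at `q^{-s}`. -/
def eulerFactor (W : WeierstrassCurve K) (v : HeightOneSpectrum (𝓞 K)) (s : ℂ) : ℂ :=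
  Polynomial.aeval ((primeNorm v : ℂ) ^ (-s))
    ((W.baseChange (v.adicCompletion K)).localPolynomial (v.adicCompletionIntegers K))

/-- The master quadratic of `V` produces the Euler factor of `W` at `v`: it is a genuine quadratic
with a nonzero root, and for every nonzero root `u²` the pencil at the basepoint `(u, λ)` is
invertible, with resolvent `R` satisfying `det (1 - q^{-s} R) = 1 - a q^{-s} + q^{1-2s}`, the Euler
factor. -/
def ProducesEulerFactor (V : CausalPencil QBar) (W : WeierstrassCurve K)
    (v : HeightOneSpectrum (𝓞 K)) : Prop :=
  let q : ℂ := (primeNorm v : ℂ)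
  let t : ℂ := (frobTrace W v : ℂ)
  let Vc := V.toComplex
  Vc.tau ≠ 0 ∧ Vc.masterA ≠ 0 ∧
  (∃ Y : ℂ, Y ≠ 0 ∧ Vc.IsMasterRoot t q Y) ∧
  ∀ u : ℂ, u ≠ 0 → Vc.IsMasterRoot t q (u ^ 2) →
    let A := Vc.pencil u (Vc.basepointLambda t q u)
    IsUnit A.det ∧
    ∀ s : ℂ, (1 - q ^ (-s) • A⁻¹).det = 1 - t * q ^ (-s) + q ^ (1 - 2 * s) ∧
      (1 - q ^ (-s) • A⁻¹).det = eulerFactor W v s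

end Arithmetic

/-- The pencil `V` realises the elliptic curve `E`: the value of the `j`-moduli map is `j(E)`, the
spectral curve is isomorphic to `E`, and for every model of `E` over a number field and every good
prime of that model, the master quadratic of `V` produces the Euler factor. -/
def Realises (V : CausalPencil QBar) (E : WeierstrassCurve QBar) [E.IsElliptic] : Prop :=
  V.IsSmooth ∧ V.jMap = E.j ∧ V.SpectralCurveIso E ∧
  ∀ (K : Type) [Field K] [NumberField K] (ι : K →+* QBar) (W : WeierstrassCurve K),
    (∃ C : WeierstrassCurve.VariableChange QBar, C • W.map ι = E) →
    ∀ v : HeightOneSpectrum (𝓞 K), GoodPrime W v → ProducesEulerFactor V W v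

end

/-! For a `2 × 2` matrix, `det (1 - x A⁻¹) = 1 - x (tr A / det A) + x² / det A`, so the Euler factor
only asks for `tr A = t/q` and `det A = 1/q`. The trace condition fixes `λ`, and the determinant
condition then is the master quadratic in `u²`. Hence any pencil with `τ ≠ 0` and `𝒜 ≠ 0` works at a
good prime, unless `ℬ = 𝒞 = 0`, when `0` is the only root.

The spectral polynomial is quadratic in `λ` with discriminant `u² (αu⁴ + βu² + γ)`, where `α = τ² -
4Δ`, `β = 2τδ`, `γ = δ² + 4Δ`. The curve is thus birational to `w² = αu⁴ + βu² + γ`, whose Jacobian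
has `j`-invariant `jMap`. Over an algebraically closed field `j` determines the function field
(`IsSmooth.spectralCurveIso`).

Moreover `j` depends only on `c = β² / 4αγ` (`IsSmooth.jMap_eq`), which leaves a one-parameter
family of pencils with `b = 1/2`. Eliminating `t` from `ℬ = 𝒞 = 0` leaves a relation in `q` alone
(`masterA_sq_mul_eq`), and the parameter is chosen to violate it for every `q > 1`. In the
self-adjoint case `c` is real, and `T = τ²`, `D = δ²` must also be nonnegative. Density holds
because infinite subsets of the projective line are dense. -/

/-! ### Residue fields of completions and the Euler factor -/

theorem exists_algebraMap_valued_sub_lt_one {K : Type*} [Field K] [NumberField K]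
    (v : HeightOneSpectrum (𝓞 K)) (x : v.adicCompletion K) :
    ∃ k : K, Valued.v (algebraMap K (v.adicCompletion K) k - x) < 1 := by
  have hmem : {y : v.adicCompletion K | Valued.v (y - x) < 1} ∈ nhds x := by
    rw [Valued.mem_nhds]
    refine ⟨1, fun y hy => ?_⟩
    simpa [Valuation.restrict_lt_one_iff] using hy
  obtain ⟨k, hk⟩ := (v.denseRange_algebraMap (K := K)).exists_mem_open isOpen_interior
    ⟨x, mem_interior_iff_mem_nhds.mpr hmem⟩
  have hk' := interior_subset hk
  exact ⟨k, hk'⟩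

/-- A class is approximated by an element of `K`, by density; that element is `v`-integral, hence
congruent to an element of `𝓞 K`. -/
theorem residue_algebraMap_surjective {K : Type*} [Field K] [NumberField K]
    (v : HeightOneSpectrum (𝓞 K)) :
    Function.Surjective ((IsLocalRing.residue (v.adicCompletionIntegers K)).comp
      (algebraMap (𝓞 K) (v.adicCompletionIntegers K))) := by
  intro z
  obtain ⟨x, rfl⟩ := IsLocalRing.residue_surjective z
  obtain ⟨k, hk⟩ := exists_algebraMap_valued_sub_lt_one v (x : v.adicCompletion K)
  have hx : Valued.v (x : v.adicCompletion K) ≤ 1 := x.2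
  have hk1 : v.valuation K k ≤ 1 := by
    rw [← HeightOneSpectrum.valuedAdicCompletion_eq_valuation' v k]
    have := Valuation.map_add Valued.v (algebraMap K (v.adicCompletion K) k - x) x
    rw [sub_add_cancel] at this
    exact this.trans (max_le hk.le hx)
  obtain ⟨a, ha⟩ := HeightOneSpectrum.exists_valuation_sub_lt_of_integer v hk1 1
  refine ⟨a, ?_⟩
  rw [RingHom.comp_apply, ← sub_eq_zero, ← map_sub, IsLocalRing.residue_eq_zero_iff]
  have hmax : ∀ y : v.adicCompletionIntegers K, Valued.v (y : v.adicCompletion K) < 1 →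
      y ∈ IsLocalRing.maximalIdeal (v.adicCompletionIntegers K) := by
    intro y hy
    rw [IsLocalRing.mem_maximalIdeal, mem_nonunits_iff,
      HeightOneSpectrum.adicCompletionIntegers.isUnit_iff_valued_eq_one]
    exact hy.ne
  refine hmax _ ?_
  have h1 : Valued.v (algebraMap K (v.adicCompletion K) (algebraMap (𝓞 K) K a - k)) < 1 := by
    have := HeightOneSpectrum.valuedAdicCompletion_eq_valuation' v (algebraMap (𝓞 K) K a - k)
    exact this.trans_lt (by simpa using ha)
  have h2 := Valuation.map_add_lt Valued.v h1 hk
  rw [map_sub, sub_add_sub_cancel] at h2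
  exact h2

/-- Needed for `q > 1`: `Nat.card` of an infinite residue field would be `0`. -/
theorem finite_residueField_adicCompletionIntegers {K : Type*} [Field K] [NumberField K]
    (v : HeightOneSpectrum (𝓞 K)) :
    Finite (IsLocalRing.ResidueField (v.adicCompletionIntegers K)) := by
  have hfin : Finite (𝓞 K ⧸ v.asIdeal) := v.asIdeal.finiteQuotientOfFreeOfNeBot v.ne_bot
  let f := (IsLocalRing.residue (v.adicCompletionIntegers K)).comp
      (algebraMap (𝓞 K) (v.adicCompletionIntegers K))
  have hf : ∀ a ∈ v.asIdeal, f a = 0 := by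
    intro a ha
    rw [RingHom.comp_apply, IsLocalRing.residue_eq_zero_iff, IsLocalRing.mem_maximalIdeal,
      mem_nonunits_iff, HeightOneSpectrum.adicCompletionIntegers.isUnit_iff_valued_eq_one]
    refine ne_of_lt ?_
    have := HeightOneSpectrum.valuedAdicCompletion_eq_valuation (K := K) v a
    exact this.trans_lt ((HeightOneSpectrum.valuation_lt_one_iff_mem v a).mpr ha)
  exact Finite.of_surjective (Ideal.Quotient.lift v.asIdeal f hf)
    (Ideal.Quotient.lift_surjective_of_surjective _ _ (residue_algebraMap_surjective v))

theorem one_lt_primeNorm {K : Type} [Field K] [NumberField K] (v : HeightOneSpectrum (𝓞 K)) :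
    1 < primeNorm v :=
  have := finite_residueField_adicCompletionIntegers v
  Finite.one_lt_card

theorem Complex.cpow_one_sub_two_mul {q : ℂ} (hq : q ≠ 0) (s : ℂ) :
    q ^ (1 - 2 * s) = q * (q ^ (-s)) ^ 2 := by
  rw [sub_eq_add_neg, Complex.cpow_add _ _ hq, Complex.cpow_one, ← Complex.cpow_nat_mul]
  congr 2
  push_cast
  ring

theorem eulerFactor_eq_of_goodPrime {K : Type} [Field K] [NumberField K] {W : WeierstrassCurve K}
    {v : HeightOneSpectrum (𝓞 K)} (h : GoodPrime W v) (s : ℂ) :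
    eulerFactor W v s = 1 - (frobTrace W v : ℂ) * (primeNorm v : ℂ) ^ (-s) +
      (primeNorm v : ℂ) ^ (1 - 2 * s) := by
  have hq : (primeNorm v : ℂ) ≠ 0 := by exact_mod_cast (one_lt_primeNorm v).ne_bot
  rw [Complex.cpow_one_sub_two_mul hq, eulerFactor, WeierstrassCurve.localPolynomial,
    if_pos (by exact h)]
  simp [frobTrace, primeNorm]

/-! ### Trace and determinant of the pencil at the basepoint -/

namespace CausalPencil

/-- With `k = λ/u`, the determinant is quadratic in `k`; substituting `kτ = 2u² - t/q` turns `τ²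
(det A - 1/q)` into minus the master quadratic. -/
theorem det_pencil_basepoint {F : Type*} [Field F] (V : CausalPencil F) {t q u : F}
    (hq : q ≠ 0) (hτ : V.tau ≠ 0) (hu : u ≠ 0) (h : V.IsMasterRoot t q (u ^ 2)) :
    (V.pencil u (V.basepointLambda t q u)).det = q⁻¹ := by
  obtain ⟨k, hk⟩ : ∃ k, k = (2 * u ^ 2 - t / q) / V.tau := ⟨_, rfl⟩
  have hl : V.basepointLambda t q u * u⁻¹ = k := by
    rw [hk, basepointLambda]
    field_simp
  have hkτ : k * V.tau = 2 * u ^ 2 - t / q := by rw [hk]; field_simp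
  have hdet : (V.pencil u (V.basepointLambda t q u)).det =
      u ^ 4 - 1 - k * (V.tau * u ^ 2 + V.delta) + k ^ 2 * V.Delta := by
    rw [pencil, hl, Matrix.det_fin_two]
    simp [systemOp, coupling, tau, delta, Delta]
    ring
  rw [hdet]
  obtain ⟨r, hr⟩ : ∃ r, r = t / q := ⟨_, rfl⟩
  have hroot : V.masterA * (u ^ 2) ^ 2 + (-(r * V.masterA) + 2 * V.delta * V.tau) * u ^ 2 +
      (V.tau ^ 2 - r * V.delta * V.tau - V.Delta * r ^ 2 + V.tau ^ 2 * q⁻¹) = 0 := by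
    rw [IsMasterRoot, masterB, masterC] at h
    rw [hr, ← h]
    ring
  rw [← hr] at hkτ
  apply mul_left_cancel₀ (pow_ne_zero 2 hτ)
  rw [masterA] at hroot
  linear_combination (V.Delta * (k * V.tau + 2 * u ^ 2 - r) - V.tau * (V.tau * u ^ 2 + V.delta)) *
    hkτ - hroot

theorem trace_pencil_basepoint {F : Type*} [Field F] (V : CausalPencil F) {t q u : F}
    (hq : q ≠ 0) (hτ : V.tau ≠ 0) (hu : u ≠ 0) :
    (V.pencil u (V.basepointLambda t q u)).trace = t * q⁻¹ := by
  have hl : V.basepointLambda t q u * u⁻¹ = (2 * u ^ 2 - t / q) / V.tau := by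
    rw [basepointLambda]
    field_simp
  have hτ' : V.a + V.d ≠ 0 := hτ
  rw [pencil, hl, Matrix.trace_fin_two]
  simp [systemOp, coupling, tau]
  field_simp
  ring

end CausalPencil

theorem Matrix.det_one_sub_smul_inv_fin_two {F : Type*} [Field F] (A : Matrix (Fin 2) (Fin 2) F)
    (hA : IsUnit A.det) (x : F) :
    (1 - x • A⁻¹).det = 1 - x * (A.trace / A.det) + x ^ 2 / A.det := by
  have h0 : A.det ≠ 0 := hA.ne_zero
  have h : (1 - x • A⁻¹).det * A.det = (A - x • 1).det := by
    rw [← Matrix.det_mul, sub_mul, one_mul, smul_mul_assoc, Matrix.nonsing_inv_mul _ hA]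
  rw [eq_div_of_mul_eq h0 h]
  field_simp
  simp [Matrix.det_fin_two, Matrix.trace_fin_two]
  ring

theorem exists_ne_zero_quadratic_eq_zero {F : Type*} [Field F] [IsAlgClosed F] [NeZero (2 : F)]
    {a b c : F} (ha : a ≠ 0) (hbc : b ≠ 0 ∨ c ≠ 0) : ∃ x, x ≠ 0 ∧ a * x ^ 2 + b * x + c = 0 := by
  obtain ⟨x, hx⟩ := exists_quadratic_eq_zero ha (IsAlgClosed.exists_eq_mul_self (discrim a b c))
  by_cases hx0 : x = 0
  · obtain rfl : c = 0 := by simpa [hx0] using hx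
    have hb : b ≠ 0 := by simpa using hbc
    refine ⟨-b / a, div_ne_zero (neg_ne_zero.mpr hb) ha, ?_⟩
    field_simp
    ring
  · exact ⟨x, hx0, by rw [sq, hx]⟩

/-- The only obstruction to a nonzero root is that the quadratic degenerates to `𝒜 Y² = 0`. -/
theorem producesEulerFactor_of_masterB_or_masterC_ne_zero {K : Type} [Field K] [NumberField K]
    {V : CausalPencil QBar} {W : WeierstrassCurve K} {v : HeightOneSpectrum (𝓞 K)}
    (hgood : GoodPrime W v) (hτ : V.toComplex.tau ≠ 0) (hA : V.toComplex.masterA ≠ 0)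
    (hBC : V.toComplex.masterB (frobTrace W v) (primeNorm v) ≠ 0 ∨
      V.toComplex.masterC (frobTrace W v) (primeNorm v) ≠ 0) :
    ProducesEulerFactor V W v := by
  have hq : (primeNorm v : ℂ) ≠ 0 := by exact_mod_cast (one_lt_primeNorm v).ne_bot
  refine ⟨hτ, hA, exists_ne_zero_quadratic_eq_zero hA hBC, fun u hu hroot => ?_⟩
  have hdet := V.toComplex.det_pencil_basepoint hq hτ hu hroot
  have htr := V.toComplex.trace_pencil_basepoint (t := (frobTrace W v : ℂ)) hq hτ hu
  have hunit : IsUnit (V.toComplex.pencil u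
      (V.toComplex.basepointLambda (frobTrace W v) (primeNorm v) u)).det := by
    rw [hdet]
    exact (inv_ne_zero hq).isUnit
  refine ⟨hunit, fun s => ?_⟩
  have h : (1 - (primeNorm v : ℂ) ^ (-s) • (V.toComplex.pencil u
      (V.toComplex.basepointLambda (frobTrace W v) (primeNorm v) u))⁻¹).det =
      1 - (frobTrace W v : ℂ) * (primeNorm v : ℂ) ^ (-s) + (primeNorm v : ℂ) ^ (1 - 2 * s) := by
    rw [Matrix.det_one_sub_smul_inv_fin_two _ hunit, hdet, htr, Complex.cpow_one_sub_two_mul hq]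
    field_simp
  exact ⟨h, h.trans (eulerFactor_eq_of_goodPrime hgood s).symm⟩

/-! ### Function fields of plane curves and of Weierstrass curves -/

open Polynomial in
theorem Polynomial.nonempty_fractionRing_adjoinRoot_algEquiv {F L : Type*} [Field F] [Field L]
    [Algebra F L] {P : F[X][X]} (hirr : Irreducible P) (hlead : IsUnit P.leadingCoeff) {x y : L}
    (hx : Transcendental F x) (hP : P.eval₂ (aeval x : F[X] →ₐ[F] L).toRingHom y = 0)
    (hgen : IntermediateField.adjoin F {x, y} = ⊤) :
    Nonempty (FractionRing (AdjoinRoot P) ≃ₐ[F] L) := by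
  have : IsDomain (AdjoinRoot P) := AdjoinRoot.isDomain_of_prime hirr.prime
  obtain ⟨c, hc⟩ := hlead.exists_left_inv
  have hroot : IsIntegral F[X] (AdjoinRoot.root P) := by
    refine ⟨C c * P, ?_, ?_⟩
    · rw [Monic, leadingCoeff_mul, leadingCoeff_C, hc]
    · rw [eval₂_mul, AdjoinRoot.algebraMap_eq, AdjoinRoot.eval₂_root, mul_zero]
  have : Algebra.IsIntegral F[X] (AdjoinRoot P) := by
    refine ⟨fun a => ?_⟩
    have hle : Algebra.adjoin F[X] {AdjoinRoot.root P} ≤ integralClosure F[X] (AdjoinRoot P) :=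
      Algebra.adjoin_le (Set.singleton_subset_iff.mpr hroot)
    rw [AdjoinRoot.adjoinRoot_eq_top] at hle
    exact hle trivial
  let f : AdjoinRoot P →ₐ[F] L := AdjoinRoot.liftAlgHom P (aeval x) y hP
  have hfx : ∀ p : F[X], f (algebraMap F[X] (AdjoinRoot P) p) = aeval x p := fun p => by
    rw [AdjoinRoot.algebraMap_eq]
    exact AdjoinRoot.liftAlgHom_of P (aeval x) y hP p
  -- The kernel meets `F[X]` trivially because `x` is transcendental, and in an integral extension
  -- of domains only the zero ideal does so.
  have hf : Function.Injective f := by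
    rw [injective_iff_map_eq_zero]
    intro a ha
    have hbot : RingHom.ker f.toRingHom = ⊥ := by
      refine Ideal.eq_bot_of_comap_eq_bot (R := F[X]) (eq_bot_iff.mpr fun p hp => ?_)
      have hp' : aeval x p = 0 := (hfx p).symm.trans hp
      exact (transcendental_iff.mp hx) p hp'
    exact (Submodule.mem_bot _).mp (hbot ▸ (show a ∈ RingHom.ker f.toRingHom from ha))
  let g : FractionRing (AdjoinRoot P) →ₐ[F] L := IsFractionRing.liftAlgHom hf
  have hg : ∀ a : AdjoinRoot P, g (algebraMap _ _ a) = f a :=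
    fun a => IsFractionRing.lift_algebraMap hf a
  refine ⟨AlgEquiv.ofBijective g ⟨g.toRingHom.injective, ?_⟩⟩
  have htop : g.fieldRange = ⊤ := by
    rw [eq_top_iff, ← hgen, IntermediateField.adjoin_le_iff]
    rintro z (rfl | rfl)
    · exact ⟨algebraMap _ _ (algebraMap F[X] (AdjoinRoot P) X),
        (hg _).trans ((hfx X).trans (aeval_X _))⟩
    · exact ⟨algebraMap _ _ (AdjoinRoot.root P), (hg _).trans (AdjoinRoot.liftAlgHom_root ..)⟩
  intro z
  exact (htop ▸ trivial : z ∈ g.fieldRange)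

namespace WeierstrassCurve.Affine

open Polynomial

variable {F : Type*} [Field F] (W : WeierstrassCurve.Affine F)

/-- The coordinate function `x` of a Weierstrass curve. -/
noncomputable def functionX : W.FunctionField :=
  algebraMap W.CoordinateRing _ (CoordinateRing.mk W (C X))

/-- The coordinate function `y` of a Weierstrass curve. -/
noncomputable def functionY : W.FunctionField :=
  algebraMap W.CoordinateRing _ (CoordinateRing.mk W X)

theorem aeval_functionX (p : F[X]) :
    aeval W.functionX p = algebraMap W.CoordinateRing W.FunctionField
      (algebraMap F[X] W.CoordinateRing p) := by
  have h : W.functionX = algebraMap W.CoordinateRing W.FunctionField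
      (algebraMap F[X] W.CoordinateRing X) := rfl
  rw [h, aeval_algebraMap_apply, aeval_algebraMap_apply, aeval_X_left_apply]

theorem transcendental_functionX : Transcendental F W.functionX := by
  rw [transcendental_iff]
  intro p hp
  rw [aeval_functionX] at hp
  rw [map_eq_zero_iff _ (IsFractionRing.injective _ _)] at hp
  exact (map_eq_zero_iff _ (FaithfulSMul.algebraMap_injective F[X] W.CoordinateRing)).mp hp

theorem functionX_functionY_equation :
    W.functionY ^ 2 + algebraMap F _ W.a₁ * W.functionX * W.functionY +
      algebraMap F _ W.a₃ * W.functionY = W.functionX ^ 3 +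
      algebraMap F _ W.a₂ * W.functionX ^ 2 + algebraMap F _ W.a₄ * W.functionX +
      algebraMap F _ W.a₆ := by
  have h : algebraMap W.CoordinateRing W.FunctionField (CoordinateRing.mk W W.polynomial) = 0 := by
    rw [AdjoinRoot.mk_self, map_zero]
  have hC : ∀ a : F, algebraMap W.CoordinateRing W.FunctionField (CoordinateRing.mk W (C (C a))) =
      algebraMap F W.FunctionField a := fun a => rfl
  simp only [WeierstrassCurve.Affine.polynomial, map_add, map_mul, map_pow, map_sub, hC] at h
  rw [← sub_eq_zero, ← h]
  simp only [functionX, functionY]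
  ring

theorem adjoin_functionX_functionY :
    IntermediateField.adjoin F {W.functionX, W.functionY} = ⊤ := by
  rw [eq_top_iff]
  intro z _
  obtain ⟨a, b, _, rfl⟩ := IsFractionRing.div_surjective (A := W.CoordinateRing) z
  have hx : W.functionX ∈ IntermediateField.adjoin F {W.functionX, W.functionY} :=
    IntermediateField.subset_adjoin _ _ (by simp)
  have hy : W.functionY ∈ IntermediateField.adjoin F {W.functionX, W.functionY} :=
    IntermediateField.subset_adjoin _ _ (by simp)
  have hmem : ∀ a : W.CoordinateRing, algebraMap W.CoordinateRing W.FunctionField a ∈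
      IntermediateField.adjoin F {W.functionX, W.functionY} := by
    intro a
    obtain ⟨p, q, rfl⟩ := CoordinateRing.exists_smul_basis_eq a
    have haev : ∀ p : F[X], aeval W.functionX p ∈
        IntermediateField.adjoin F {W.functionX, W.functionY} := fun p => by
      exact IntermediateField.algebra_adjoin_le_adjoin F _
        (Algebra.adjoin_mono (by simp) (aeval_mem_adjoin_singleton F W.functionX))
    rw [Algebra.smul_def, Algebra.smul_def, mul_one, map_add, map_mul, ← aeval_functionX,
      ← aeval_functionX]
    exact add_mem (haev p) (mul_mem (haev q) hy)
  exact div_mem (hmem a) (hmem b)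

/-- A change of variables provides generators of the function field which satisfy the transformed
Weierstrass equation. -/
theorem exists_generators_of_variableChange (C : WeierstrassCurve.VariableChange F)
    {W' : WeierstrassCurve F} (h : C • (W : WeierstrassCurve F) = W') :
    ∃ x y : W.FunctionField, Transcendental F x ∧ IntermediateField.adjoin F {x, y} = ⊤ ∧
      y ^ 2 + algebraMap F _ W'.a₁ * x * y + algebraMap F _ W'.a₃ * y =
        x ^ 3 + algebraMap F _ W'.a₂ * x ^ 2 + algebraMap F _ W'.a₄ * x +
          algebraMap F _ W'.a₆ := by
  subst h
  let φ := algebraMap F W.FunctionField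
  have hv : φ ↑C.u⁻¹ * φ ↑C.u = 1 := by rw [← map_mul]; simp
  obtain ⟨x, hx⟩ : ∃ x, x = φ ↑C.u⁻¹ ^ 2 * (W.functionX - φ C.r) := ⟨_, rfl⟩
  obtain ⟨y, hy⟩ : ∃ y, y = φ ↑C.u⁻¹ ^ 3 *
    (W.functionY - φ C.s * (W.functionX - φ C.r) - φ C.t) := ⟨_, rfl⟩
  have hX : W.functionX = φ C.u ^ 2 * x + φ C.r := by
    linear_combination -φ ↑C.u ^ 2 * hx - (W.functionX - φ C.r) * (φ ↑C.u⁻¹ * φ ↑C.u + 1) * hv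
  have hY : W.functionY = φ C.u ^ 3 * y + φ C.s * (W.functionX - φ C.r) + φ C.t := by
    linear_combination -φ ↑C.u ^ 3 * hy - (W.functionY - φ C.s * (W.functionX - φ C.r) - φ C.t) *
      ((φ ↑C.u⁻¹ * φ ↑C.u) ^ 2 + φ ↑C.u⁻¹ * φ ↑C.u + 1) * hv
  refine ⟨x, y, fun halg => W.transcendental_functionX ?_, ?_, ?_⟩
  · rw [hX]
    exact (((isAlgebraic_algebraMap _).pow 2).mul halg).add (isAlgebraic_algebraMap _)
  · have hφ : ∀ a, φ a ∈ IntermediateField.adjoin F {x, y} :=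
      fun a => IntermediateField.algebraMap_mem _ a
    have hXm : W.functionX ∈ IntermediateField.adjoin F {x, y} := by
      rw [hX]
      exact add_mem (mul_mem (pow_mem (hφ _) 2)
        (IntermediateField.subset_adjoin _ _ (by simp))) (hφ _)
    rw [eq_top_iff, ← adjoin_functionX_functionY, IntermediateField.adjoin_le_iff]
    rintro z (rfl | rfl)
    · exact hXm
    · rw [hY]
      exact add_mem (add_mem (mul_mem (pow_mem (hφ _) 3)
        (IntermediateField.subset_adjoin _ _ (by simp)))
        (mul_mem (hφ _) (sub_mem hXm (hφ _)))) (hφ _)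
  · have hE := W.functionX_functionY_equation
    simp only [WeierstrassCurve.variableChange_a₁, WeierstrassCurve.variableChange_a₂,
      WeierstrassCurve.variableChange_a₃, WeierstrassCurve.variableChange_a₄,
      WeierstrassCurve.variableChange_a₆, map_mul, map_add, map_sub, map_pow, map_ofNat, hx, hy, φ]
    linear_combination φ ↑C.u⁻¹ ^ 6 * hE

end WeierstrassCurve.Affine

/-! ### The spectral curve and its Jacobian -/

open Polynomial in
/-- A biquadratic polynomial with nonzero discriminant is not a square. -/
theorem Polynomial.sq_ne_biquadratic {F : Type*} [Field F] [NeZero (2 : F)] {α β γ : F}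
    (hα : α ≠ 0) (hd : β ^ 2 - 4 * α * γ ≠ 0) (g : F[X]) :
    g ^ 2 ≠ C α * X ^ 4 + C β * X ^ 2 + C γ := by
  intro h
  have hdeg : g.natDegree ≤ 2 := by
    have h1 : (g ^ 2).natDegree ≤ 4 := by
      rw [h]
      compute_degree
    rw [natDegree_pow] at h1
    omega
  obtain ⟨a, b, c, rfl⟩ : ∃ a b c, g = C a * X ^ 2 + C b * X + C c :=
    ⟨_, _, _, eq_quadratic_of_degree_le_two (natDegree_le_iff_degree_le.mp hdeg)⟩
  have hexp : (C a * X ^ 2 + C b * X + C c : F[X]) ^ 2 = C (a ^ 2) * X ^ 4 + C (2 * a * b) * X ^ 3 +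
      C (b ^ 2 + 2 * a * c) * X ^ 2 + C (2 * b * c) * X + C (c ^ 2) := by
    simp only [C_mul, C_add, C_pow, C_ofNat]
    ring
  rw [hexp] at h
  have h4 : a ^ 2 = α := by
    simpa [-map_mul, -map_add, -map_pow, coeff_X, coeff_C] using congrArg (coeff · 4) h
  have h3 : 2 * a * b = 0 := by
    simpa [-map_mul, -map_add, -map_pow, coeff_X, coeff_C] using congrArg (coeff · 3) h
  have h2 : b ^ 2 + 2 * a * c = β := by
    simpa [-map_mul, -map_add, -map_pow, coeff_X, coeff_C] using congrArg (coeff · 2) h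
  have h0 : c ^ 2 = γ := by
    simpa [-map_mul, -map_add, -map_pow, coeff_X, coeff_C] using congrArg (coeff · 0) h
  have ha : a ≠ 0 := fun ha => hα (by rw [← h4, ha]; ring)
  -- Without a cubic term the square root is `aX² + c`, whose square has `β² = 4αγ`.
  obtain rfl : b = 0 := by simpa [ha, NeZero.ne] using h3
  apply hd
  rw [← h4, ← h2, ← h0]
  ring

namespace CausalPencil

variable {F : Type*} [Field F] {V : CausalPencil F}

theorem IsSmooth.Delta_ne_zero (h : V.IsSmooth) : V.Delta ≠ 0 := by
  rintro h0; simp [IsSmooth, h0] at h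

theorem IsSmooth.mu_ne_zero (h : V.IsSmooth) : V.mu ≠ 0 := by
  rintro h0; simp [IsSmooth, h0] at h

theorem IsSmooth.b_ne_zero (h : V.IsSmooth) : V.b ≠ 0 := by
  rintro h0; exact h.mu_ne_zero (by simp [mu, h0])

theorem IsSmooth.masterA_ne_zero (h : V.IsSmooth) : V.masterA ≠ 0 := by
  rintro h0; rw [masterA] at h0; simp [IsSmooth, h0] at h

theorem IsSmooth.delta_sq_add_ne_zero (h : V.IsSmooth) : V.delta ^ 2 + 4 * V.Delta ≠ 0 := by
  rintro h0; simp [IsSmooth, h0] at h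

/-- Smoothness thus says that `αu⁴ + βu² + γ` has nonzero `α`, `γ` and `β² - 4αγ`, hence four
distinct roots. -/
theorem discrim_eq (V : CausalPencil F) :
    (2 * V.tau * V.delta) ^ 2 - 4 * V.masterA * (V.delta ^ 2 + 4 * V.Delta) =
      64 * V.Delta * V.b ^ 2 := by
  simp only [masterA, tau, delta, Delta]
  ring

theorem IsSmooth.discrim_ne_zero [CharZero F] (h : V.IsSmooth) :
    (2 * V.tau * V.delta) ^ 2 - 4 * V.masterA * (V.delta ^ 2 + 4 * V.Delta) ≠ 0 := by
  rw [discrim_eq]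
  exact mul_ne_zero (mul_ne_zero (by norm_num) h.Delta_ne_zero) (pow_ne_zero 2 h.b_ne_zero)

open Polynomial

theorem spectralPoly_eq (V : CausalPencil F) :
    V.spectralPoly = C (C V.Delta) * X ^ 2 + C (-(X * (C V.tau * X ^ 2 + C V.delta))) * X +
      C (X ^ 6 - X ^ 2) := by
  rw [spectralPoly, Matrix.det_fin_two]
  simp [systemOp, coupling, tau, delta, Delta]
  ring

/-- Up to a unit the polynomial is monic of degree 2 in `λ`, so a factorisation gives a root in
`F[u]`, and then the discriminant, hence the quartic, would be a square. -/
theorem IsSmooth.irreducible_spectralPoly [CharZero F] (h : V.IsSmooth) :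
    Irreducible V.spectralPoly := by
  have hΔ := h.Delta_ne_zero
  have hΔu : IsUnit (C (C V.Delta⁻¹) : F[X][X]) :=
    ((inv_ne_zero hΔ).isUnit.map C).map C
  have hinv : (C V.Delta⁻¹ * C V.Delta : F[X]) = 1 := by
    rw [← C_mul, inv_mul_cancel₀ hΔ, C_1]
  have hΔC : (C V.Delta : F[X]) ≠ 0 := by simpa using hΔ
  rw [← irreducible_isUnit_mul hΔu]
  have hlead : (C (C V.Delta⁻¹) * V.spectralPoly).Monic := by
    rw [Monic, leadingCoeff_mul, leadingCoeff_C, spectralPoly_eq, leadingCoeff_quadratic hΔC, hinv]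
  have hdeg : (C (C V.Delta⁻¹) * V.spectralPoly).natDegree = 2 := by
    rw [natDegree_C_mul (by simpa using hΔ), spectralPoly_eq, natDegree_quadratic hΔC]
  rw [hlead.irreducible_iff_roots_eq_zero_of_degree_le_three hdeg.ge (by omega),
    Multiset.eq_zero_iff_forall_notMem]
  intro f hf
  have hroot : V.spectralPoly.eval f = 0 := by
    have := isRoot_of_mem_roots hf
    rw [IsRoot, eval_mul, eval_C, mul_eq_zero] at this
    exact this.resolve_left (by simpa using hΔ)
  rw [spectralPoly_eq] at hroot
  simp only [eval_add, eval_mul, eval_C, eval_pow, eval_X] at hroot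
  have hsq : (2 * C V.Delta * f - X * (C V.tau * X ^ 2 + C V.delta)) ^ 2 =
      X ^ 2 * (C V.masterA * X ^ 4 + C (2 * V.tau * V.delta) * X ^ 2 +
        C (V.delta ^ 2 + 4 * V.Delta)) := by
    simp only [masterA, C_mul, C_add, C_sub, C_pow, C_ofNat]
    linear_combination 4 * C V.Delta * hroot
  obtain ⟨g, hg⟩ : X ∣ 2 * C V.Delta * f - X * (C V.tau * X ^ 2 + C V.delta) :=
    prime_X.dvd_of_dvd_pow (n := 2) (by rw [hsq]; exact (dvd_pow_self X two_ne_zero).mul_right _)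
  rw [hg, mul_pow] at hsq
  exact sq_ne_biquadratic h.masterA_ne_zero h.discrim_ne_zero g
    (mul_left_cancel₀ (pow_ne_zero 2 X_ne_zero) hsq)

/-- The Weierstrass curve `y² = (x + β)(x² - 4αγ)`, the Jacobian of the quartic
`w² = αu⁴ + βu² + γ` attached to the spectral curve. -/
def jacobian (V : CausalPencil F) : WeierstrassCurve F where
  a₁ := 0
  a₂ := 2 * V.tau * V.delta
  a₃ := 0
  a₄ := -4 * V.masterA * (V.delta ^ 2 + 4 * V.Delta)
  a₆ := -4 * V.masterA * (V.delta ^ 2 + 4 * V.Delta) * (2 * V.tau * V.delta)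

theorem jacobian_discr (V : CausalPencil F) :
    V.jacobian.Δ = 256 * V.masterA * (V.delta ^ 2 + 4 * V.Delta) * (64 * V.Delta * V.b ^ 2) ^ 2 := by
  rw [← discrim_eq]
  simp only [jacobian, WeierstrassCurve.Δ, WeierstrassCurve.b₂, WeierstrassCurve.b₄,
    WeierstrassCurve.b₆, WeierstrassCurve.b₈]
  ring

theorem jacobian_c₄ (V : CausalPencil F) :
    V.jacobian.c₄ = 256 * (V.tau ^ 2 * V.delta ^ 2 + 12 * V.Delta * V.mu) := by
  simp only [jacobian, WeierstrassCurve.c₄, WeierstrassCurve.b₂, WeierstrassCurve.b₄, masterA, mu,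
    tau, delta, Delta]
  ring

theorem IsSmooth.jacobian_isElliptic [CharZero F] (h : V.IsSmooth) : V.jacobian.IsElliptic := by
  rw [WeierstrassCurve.isElliptic_iff, jacobian_discr, isUnit_iff_ne_zero]
  have h1 := h.masterA_ne_zero
  have h2 := h.delta_sq_add_ne_zero
  have h3 := h.Delta_ne_zero
  have h4 := h.b_ne_zero
  simp [*]

theorem IsSmooth.jacobian_j [CharZero F] (h : V.IsSmooth) [V.jacobian.IsElliptic] :
    V.jacobian.j = V.jMap := by
  have h1 : V.tau ^ 2 - 4 * V.Delta ≠ 0 := h.masterA_ne_zero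
  have h2 := h.delta_sq_add_ne_zero
  have h3 := h.Delta_ne_zero
  have h4 := h.b_ne_zero
  rw [WeierstrassCurve.j, Units.val_inv_eq_inv_val, WeierstrassCurve.coe_Δ', jacobian_discr,
    jacobian_c₄, jMap, masterA, mu]
  field_simp
  ring

theorem IsSmooth.nonempty_fractionRing_algEquiv [CharZero F] [IsAlgClosed F] (h : V.IsSmooth)
    {L : Type*} [Field L] [Algebra F L] {x y : L} (hx : Transcendental F x)
    (hgen : IntermediateField.adjoin F {x, y} = ⊤)
    (heq : y ^ 2 = (x + algebraMap F L (2 * V.tau * V.delta)) *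
      (x ^ 2 - 4 * algebraMap F L (V.masterA * (V.delta ^ 2 + 4 * V.Delta)))) :
    Nonempty (FractionRing (AdjoinRoot V.spectralPoly) ≃ₐ[F] L) := by
  let φ := algebraMap F L
  -- A square root of `α` makes the points at infinity of the quartic rational, which identifies it
  -- with its Jacobian.
  obtain ⟨s, hs⟩ := IsAlgClosed.exists_pow_nat_eq V.masterA two_pos
  have hs0 : s ≠ 0 := by
    rintro rfl
    exact h.masterA_ne_zero (by rw [← hs]; ring)
  have : CharZero L := charZero_of_injective_algebraMap φ.injective
  have h4 : (4 : L) ≠ 0 := by norm_num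
  have hφs : φ s ≠ 0 := by simpa using hs0
  have hφs2 : φ s ^ 2 = φ V.tau ^ 2 - 4 * φ V.Delta := by
    rw [← map_pow, hs, masterA, map_sub, map_mul, map_pow, map_ofNat]
  have hΔ : φ V.Delta ≠ 0 := by simpa using h.Delta_ne_zero
  have hβ : φ (2 * V.tau * V.delta) = 2 * φ V.tau * φ V.delta := by
    rw [map_mul, map_mul, map_ofNat]
  have hxβ : x + 2 * φ V.tau * φ V.delta ≠ 0 := by
    rw [← hβ]
    intro h0
    apply hx
    rw [eq_neg_of_add_eq_zero_left h0]
    exact (isAlgebraic_algebraMap _).neg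
  have heq' : y ^ 2 = (x + 2 * φ V.tau * φ V.delta) *
      (x ^ 2 - 4 * (φ s ^ 2 * (φ V.delta ^ 2 + 4 * φ V.Delta))) := by
    rw [heq, ← hβ, ← hs]
    simp only [map_mul, map_add, map_pow, map_ofNat, φ]
  -- This inverts the map `x = 2s(w + su²)`, `y = 2s(x + β)u` from the quartic to the cubic.
  obtain ⟨u, hu⟩ : ∃ u, u = y / (2 * φ s * (x + 2 * φ V.tau * φ V.delta)) := ⟨_, rfl⟩
  obtain ⟨w, hw⟩ : ∃ w, w = x / (2 * φ s) - φ s * u ^ 2 := ⟨_, rfl⟩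
  have hyu : y = 2 * φ s * (x + 2 * φ V.tau * φ V.delta) * u := by
    rw [hu]; field_simp
  have hxw : x = 2 * φ s * (w + φ s * u ^ 2) := by
    rw [hw]; field_simp; ring
  have hw2 : w ^ 2 = φ s ^ 2 * u ^ 4 + 2 * φ V.tau * φ V.delta * u ^ 2 +
      (φ V.delta ^ 2 + 4 * φ V.Delta) := by
    have h1 : 4 * φ s ^ 2 * (x + 2 * φ V.tau * φ V.delta) * u ^ 2 =
        x ^ 2 - 4 * (φ s ^ 2 * (φ V.delta ^ 2 + 4 * φ V.Delta)) := by
      apply mul_left_cancel₀ hxβ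
      rw [← heq', hyu]
      ring
    apply mul_left_cancel₀ (mul_ne_zero h4 (pow_ne_zero 2 hφs))
    rw [hxw] at h1
    linear_combination -h1
  have hut : Transcendental F u := by
    intro hu
    have hφ : ∀ a, IsAlgebraic F (φ a) := fun a => isAlgebraic_algebraMap a
    have h2 : IsAlgebraic F (2 : L) := map_ofNat φ 2 ▸ hφ 2
    have hw : IsAlgebraic F w := by
      have hw2' : w ^ 2 = φ s ^ 2 * u ^ 4 + φ (2 * V.tau * V.delta) * u ^ 2 +
          φ (V.delta ^ 2 + 4 * V.Delta) := by
        rw [hw2]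
        simp only [map_mul, map_add, map_pow, map_ofNat]
      refine IsAlgebraic.of_pow two_pos (hw2' ▸ ?_)
      exact ((((hφ s).pow 2).mul (hu.pow 4)).add ((hφ _).mul (hu.pow 2))).add (hφ _)
    exact hx (hxw ▸ (h2.mul (hφ s)).mul (hw.add ((hφ s).mul (hu.pow 2))))
  have hu0 : u ≠ 0 := by
    rintro rfl
    exact hut isAlgebraic_zero
  -- The quadratic formula for `λ`, with `uw` as the square root of the discriminant.
  obtain ⟨l, hl⟩ : ∃ l, l = u * ((φ V.tau * u ^ 2 + φ V.delta + w) / (2 * φ V.Delta)) := ⟨_, rfl⟩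
  have hwl : w = 2 * φ V.Delta * (l / u) - φ V.tau * u ^ 2 - φ V.delta := by
    rw [hl]; field_simp; ring
  refine nonempty_fractionRing_adjoinRoot_algEquiv h.irreducible_spectralPoly ?_ hut (y := l) ?_ ?_
  · rw [spectralPoly_eq, leadingCoeff_quadratic (by simpa using h.Delta_ne_zero)]
    exact h.Delta_ne_zero.isUnit.map C
  · rw [spectralPoly_eq]
    have hl2 : φ V.Delta * l ^ 2 + -(u * (φ V.tau * u ^ 2 + φ V.delta)) * l +
        (u ^ 6 - u ^ 2) = 0 := by
      have h2l : 2 * φ V.Delta * l = u * (φ V.tau * u ^ 2 + φ V.delta + w) := by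
        rw [hl]; field_simp
      apply mul_left_cancel₀ (mul_ne_zero h4 hΔ)
      linear_combination (2 * φ V.Delta * l + u * (φ V.tau * u ^ 2 + φ V.delta + w) -
        2 * u * (φ V.tau * u ^ 2 + φ V.delta)) * h2l + u ^ 2 * hw2 + u ^ 6 * hφs2
    rw [eval₂_add, eval₂_add, eval₂_mul, eval₂_mul, eval₂_C, eval₂_C, eval₂_C, eval₂_X_pow, eval₂_X]
    simpa using hl2
  · have hφ : ∀ a, φ a ∈ IntermediateField.adjoin F {u, l} :=
      fun a => IntermediateField.algebraMap_mem _ a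
    have hum : u ∈ IntermediateField.adjoin F {u, l} :=
      IntermediateField.subset_adjoin _ _ (by simp)
    have hlm : l ∈ IntermediateField.adjoin F {u, l} :=
      IntermediateField.subset_adjoin _ _ (by simp)
    have h2 : (2 : L) ∈ IntermediateField.adjoin F {u, l} := map_ofNat φ 2 ▸ hφ 2
    have hwm : w ∈ IntermediateField.adjoin F {u, l} := by
      rw [hwl]
      exact sub_mem (sub_mem (mul_mem (mul_mem h2 (hφ _)) (div_mem hlm hum))
        (mul_mem (hφ _) (pow_mem hum 2))) (hφ _)
    have hxm : x ∈ IntermediateField.adjoin F {u, l} := by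
      rw [hxw]
      exact mul_mem (mul_mem h2 (hφ _)) (add_mem hwm (mul_mem (hφ _) (pow_mem hum 2)))
    have hym : y ∈ IntermediateField.adjoin F {u, l} := by
      rw [hyu]
      exact mul_mem (mul_mem (mul_mem h2 (hφ _))
        (add_mem hxm (mul_mem (mul_mem h2 (hφ _)) (hφ _)))) hum
    rw [eq_top_iff, ← hgen, IntermediateField.adjoin_le_iff]
    rintro z (rfl | rfl)
    exacts [hxm, hym]

theorem IsSmooth.spectralCurveIso [CharZero F] [IsAlgClosed F] (h : V.IsSmooth)
    (E : WeierstrassCurve F) [E.IsElliptic] (hj : V.jMap = E.j) : V.SpectralCurveIso E := by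
  refine ⟨h.irreducible_spectralPoly, ?_⟩
  have := h.jacobian_isElliptic
  obtain ⟨C', hC'⟩ := WeierstrassCurve.exists_variableChange_of_j_eq E V.jacobian
    (hj.symm.trans h.jacobian_j.symm)
  obtain ⟨x, y, hx, hgen, heq⟩ :=
    WeierstrassCurve.Affine.exists_generators_of_variableChange E.toAffine C' hC'
  refine h.nonempty_fractionRing_algEquiv hx hgen ?_
  simp only [jacobian, map_mul, map_add, map_neg, map_pow, map_zero, map_ofNat] at heq ⊢
  linear_combination heq

end CausalPencil

/-! ### The invariant `c` and the choice of parameters -/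

namespace CausalPencil

/-- The coupling with trace `τ`, diagonal difference `δ` and `b = 1/2`. -/
noncomputable def ofTauDelta {F : Type*} [Field F] (τ δ : F) : CausalPencil F :=
  ⟨(τ + δ) / 2, 1 / 2, (τ - δ) / 2⟩

section Field

variable {F : Type*} [Field F] [CharZero F]

@[simp] theorem tau_ofTauDelta (τ δ : F) : (ofTauDelta τ δ).tau = τ := by
  simp only [ofTauDelta, tau]; ring

@[simp] theorem delta_ofTauDelta (τ δ : F) : (ofTauDelta τ δ).delta = δ := by
  simp only [ofTauDelta, delta]; ring

@[simp] theorem Delta_ofTauDelta (τ δ : F) :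
    (ofTauDelta τ δ).Delta = (τ ^ 2 - δ ^ 2 + 1) / 4 := by
  simp only [ofTauDelta, Delta]; ring

@[simp] theorem mu_ofTauDelta (τ δ : F) : (ofTauDelta τ δ).mu = -1 / 4 := by
  simp only [ofTauDelta, mu]; ring

/-- The invariant `β² / 4αγ` of the quartic `αu⁴ + βu² + γ` attached to the spectral curve. -/
noncomputable def quarticRatio (V : CausalPencil F) : F :=
  V.tau ^ 2 * V.delta ^ 2 / ((V.tau ^ 2 - 4 * V.Delta) * (V.delta ^ 2 + 4 * V.Delta))

theorem IsSmooth.quarticRatio_ne_one {V : CausalPencil F} (h : V.IsSmooth) :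
    V.quarticRatio ≠ 1 := by
  intro h1
  have hα : V.tau ^ 2 - 4 * V.Delta ≠ 0 := h.masterA_ne_zero
  rw [quarticRatio, div_eq_one_iff_eq (mul_ne_zero hα h.delta_sq_add_ne_zero)] at h1
  apply h.discrim_ne_zero
  rw [masterA]
  linear_combination 4 * h1

theorem IsSmooth.jMap_eq {V : CausalPencil F} (h : V.IsSmooth) :
    V.jMap = 64 * (3 + V.quarticRatio) ^ 3 / (1 - V.quarticRatio) ^ 2 := by
  have hα : V.tau ^ 2 - 4 * V.Delta ≠ 0 := h.masterA_ne_zero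
  have hγ := h.delta_sq_add_ne_zero
  have hΔ := h.Delta_ne_zero
  have hμ := h.mu_ne_zero
  have h1 : 1 - V.quarticRatio ≠ 0 := sub_ne_zero.mpr h.quarticRatio_ne_one.symm
  -- With `p = αγ`, `τ²δ² = cp` and `16Δμ = (1 - c)p`, so `p` cancels from `j`.
  obtain ⟨p, hp⟩ : ∃ p, p = (V.tau ^ 2 - 4 * V.Delta) * (V.delta ^ 2 + 4 * V.Delta) := ⟨_, rfl⟩
  have hp0 : p ≠ 0 := hp ▸ mul_ne_zero hα hγ
  have hc : V.tau ^ 2 * V.delta ^ 2 = V.quarticRatio * p := by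
    rw [quarticRatio, ← hp, div_mul_cancel₀ _ hp0]
  have hm : 16 * (V.Delta * V.mu) = p * (1 - V.quarticRatio) := by
    have hrel : p = V.tau ^ 2 * V.delta ^ 2 + 16 * (V.Delta * V.mu) := by
      rw [hp]
      simp only [tau, delta, Delta, mu]
      ring
    linear_combination -hrel - hc
  have hm' : V.Delta * V.mu = p * (1 - V.quarticRatio) / 16 := by
    rw [← hm]; ring
  rw [jMap, mul_assoc _ (V.tau ^ 2 - 4 * V.Delta), ← hp, ← mul_pow V.Delta, mul_assoc 12, hc, hm']
  field_simp
  ring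

/-- For `b = 1/2`, `α = δ² - 1` and `γ = τ² + 1`; `Δ = 0` would give `τ²δ² = αγ`, that is `c = 1`.
-/
theorem isSmooth_ofTauDelta {τ δ c : F} (hc : c ≠ 1) (hδ : δ ^ 2 ≠ 1) (hτ : τ ^ 2 ≠ -1)
    (h : τ ^ 2 * δ ^ 2 = c * ((δ ^ 2 - 1) * (τ ^ 2 + 1))) :
    (ofTauDelta τ δ).IsSmooth ∧ (ofTauDelta τ δ).quarticRatio = c := by
  have hα : δ ^ 2 - 1 ≠ 0 := sub_ne_zero.mpr hδ
  have hγ : τ ^ 2 + 1 ≠ 0 := fun h0 => hτ (eq_neg_of_add_eq_zero_left h0)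
  have hα' : τ ^ 2 - 4 * ((τ ^ 2 - δ ^ 2 + 1) / 4) = δ ^ 2 - 1 := by ring
  have hγ' : δ ^ 2 + 4 * ((τ ^ 2 - δ ^ 2 + 1) / 4) = τ ^ 2 + 1 := by ring
  have hΔ : τ ^ 2 - δ ^ 2 + 1 ≠ 0 := by
    intro h0
    have : (1 - c) * ((δ ^ 2 - 1) * (τ ^ 2 + 1)) = 0 := by linear_combination h - h0
    exact mul_ne_zero (sub_ne_zero.mpr hc.symm) (mul_ne_zero hα hγ) this
  constructor
  · simp [IsSmooth, hα', hγ', hα, hγ, hΔ]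
  · simp only [quarticRatio, tau_ofTauDelta, delta_ofTauDelta, Delta_ofTauDelta, hα', hγ', h]
    field_simp

/-- `ℬ = 0` gives `t/q = 2δτ/𝒜`; inserting this into `𝒞 = 0` removes `t`. -/
theorem masterA_sq_mul_eq {V : CausalPencil F} {t q : F} (hτ : V.tau ≠ 0)
    (hB : V.masterB t q = 0) (hC : V.masterC t q = 0) :
    V.masterA ^ 2 * (1 + q⁻¹) = 2 * V.delta ^ 2 * (V.masterA + 2 * V.Delta) := by
  obtain ⟨r, hr⟩ : ∃ r, r = t * q⁻¹ := ⟨_, rfl⟩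
  have hB' : r * V.masterA = 2 * V.delta * V.tau := by
    rw [masterB] at hB
    rw [hr]
    linear_combination -hB
  have hC' : V.tau ^ 2 * (1 + q⁻¹) = r * V.delta * V.tau + V.Delta * r ^ 2 := by
    rw [masterC] at hC
    rw [hr]
    linear_combination hC
  apply mul_left_cancel₀ (pow_ne_zero 2 hτ)
  linear_combination V.masterA ^ 2 * hC' +
    (V.masterA * V.delta * V.tau + V.Delta * (r * V.masterA + 2 * V.delta * V.tau)) * hB'

end Field

end CausalPencil

/-- The parameters `T = τ²`, `D = δ²` of a coupling with `b = 1/2` and given ratio `c`, for which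
the two lower coefficients of the master quadratic do not vanish together. -/
structure AdmissibleParameters {F : Type*} [Field F] (c T D : F) : Prop where
  T_ne_zero : T ≠ 0
  T_ne_neg_one : T ≠ -1
  D_ne_one : D ≠ 1
  ratio : T * D = c * ((D - 1) * (T + 1))
  master : ∀ q : ℕ, 1 < q → (D - 1) ^ 2 * (1 + (q : F)⁻¹) ≠ D * (T + D - 1)

/-- Used to pass from real parameters to algebraic ones, through `ℂ`. -/
theorem admissibleParameters_map_iff {F K : Type*} [Field F] [Field K] (φ : F →+* K) {c T D : F} :
    AdmissibleParameters (φ c) (φ T) (φ D) ↔ AdmissibleParameters c T D := by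
  have hφ : ∀ x y, φ x = φ y ↔ x = y := fun x y => φ.injective.eq_iff
  have hT : φ T = -1 ↔ T = -1 := by rw [← hφ, map_neg, map_one]
  have hD : φ D = 1 ↔ D = 1 := by rw [← hφ, map_one]
  have hratio : φ T * φ D = φ c * ((φ D - 1) * (φ T + 1)) ↔ T * D = c * ((D - 1) * (T + 1)) := by
    rw [← hφ]; simp
  have hmaster : ∀ q : ℕ, (φ D - 1) ^ 2 * (1 + (q : K)⁻¹) = φ D * (φ T + φ D - 1) ↔
      (D - 1) ^ 2 * (1 + (q : F)⁻¹) = D * (T + D - 1) := fun q => by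
    rw [← hφ]; simp
  constructor
  · rintro ⟨h1, h2, h3, h4, h5⟩
    exact ⟨by simpa using h1, by rwa [Ne, ← hT], by rwa [Ne, ← hD], hratio.mp h4,
      fun q hq => by rw [Ne, ← hmaster]; exact h5 q hq⟩
  · rintro ⟨h1, h2, h3, h4, h5⟩
    exact ⟨by simpa using h1, by rwa [Ne, hT], by rwa [Ne, hD], hratio.mpr h4,
      fun q hq => by rw [Ne, hmaster]; exact h5 q hq⟩

theorem one_add_natCast_inv_ne_zero {F : Type*} [Field F] [CharZero F] (q : ℕ) :
    1 + (q : F)⁻¹ ≠ 0 := by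
  -- For `q = 0` the convention `0⁻¹ = 0` leaves `1`.
  rcases eq_or_ne q 0 with rfl | hq
  · simp
  · have hq' : (q : F) ≠ 0 := by exact_mod_cast hq
    intro h
    have h' : (q + 1 : F) = 0 := by
      field_simp at h
      simpa using h
    exact Nat.succ_ne_zero q (by exact_mod_cast h')

/-- This is the point of the family with `T + D = 1`: the right side of `master` vanishes and the
left side does not. -/
theorem admissibleParameters_of_sq_ne_one {F : Type*} [Field F] [CharZero F] {c : F} (hc : c ≠ 1)
    (hc' : c ≠ -1) : AdmissibleParameters c ((1 + c) / (1 - c)) (2 * c / (c - 1)) := by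
  have h1 : 1 - c ≠ 0 := sub_ne_zero.mpr hc.symm
  have h2 : c - 1 ≠ 0 := sub_ne_zero.mpr hc
  have h3 : 1 + c ≠ 0 := fun h => hc' (eq_neg_of_add_eq_zero_right h)
  have hD : 2 * c / (c - 1) - 1 = (1 + c) / (c - 1) := by field_simp; ring
  have hT : (1 + c) / (1 - c) = -((1 + c) / (c - 1)) := by rw [← div_neg, neg_sub]
  have hne : (1 + c) / (c - 1) ≠ 0 := div_ne_zero h3 h2
  refine ⟨div_ne_zero h3 h1, fun h => ?_, sub_ne_zero.mp (hD ▸ hne), ?_, fun q _ => ?_⟩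
  · rw [div_eq_iff h1] at h
    exact two_ne_zero (α := F) (by linear_combination h)
  · rw [hT]
    field_simp
    ring
  · rw [add_sub_assoc, hD, hT, neg_add_cancel, mul_zero]
    exact mul_ne_zero (pow_ne_zero 2 hne) (one_add_natCast_inv_ne_zero q)

theorem exists_admissibleParameters {F : Type*} [Field F] [CharZero F] {c : F} (hc : c ≠ 1) :
    ∃ T D, AdmissibleParameters c T D := by
  by_cases hc' : c = -1
  · subst hc'
    -- At `c = -1` the choice `T + D = 1` forces `T = 0`; for this pair the forbidden equality reads
    -- `q + 1 = 3q`.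
    refine ⟨1 / 2, 3 / 4, by norm_num, by norm_num, by norm_num, by norm_num, fun q hq h => ?_⟩
    have hq' : (q : F) ≠ 0 := by exact_mod_cast (zero_lt_one.trans hq).ne'
    field_simp at h
    have h' : (q + 1 : F) = 3 * q := by linear_combination h / 2
    have h'' : q + 1 = 3 * q := by exact_mod_cast h'
    omega
  · exact ⟨_, _, admissibleParameters_of_sq_ne_one hc hc'⟩

theorem exists_nonneg_admissibleParameters {c : ℝ} (hc : c ≠ 1) (halg : IsAlgebraic ℚ c) :
    ∃ T D : ℝ, 0 ≤ T ∧ 0 ≤ D ∧ IsAlgebraic ℚ T ∧ IsAlgebraic ℚ D ∧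
      AdmissibleParameters c T D := by
  have hnat : ∀ n : ℕ, IsAlgebraic ℚ (n : ℝ) := fun n => isAlgebraic_natCast n
  have h1 : IsAlgebraic ℚ (1 : ℝ) := isAlgebraic_one
  have h2 : IsAlgebraic ℚ (2 : ℝ) := hnat 2
  have h3 : IsAlgebraic ℚ (3 : ℝ) := hnat 3
  have hbound : ∀ q : ℕ, 1 < q → 1 + (q : ℝ)⁻¹ < 2 := fun q hq => by
    have : (q : ℝ)⁻¹ < 1 := inv_lt_one_of_one_lt₀ (by exact_mod_cast hq)
    linarith
  -- The choice `T + D = 1` has `T, D ≥ 0` and `T ≠ 0` only for `-1 < c ≤ 0`. Otherwise `D = 1 ± η`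
  -- with `η = 1/(2 + 2|c|)`, `T` is solved from `ratio`, and `master` holds since its left side is
  -- below `2η²` and its right side is not.
  rcases lt_or_ge 0 c with hpos | hneg
  · have e1 : (3 + 2 * c) / (2 + 2 * c) - 1 = 1 / (2 + 2 * c) := by field_simp; ring
    refine ⟨c / (3 + c), (3 + 2 * c) / (2 + 2 * c), by positivity, by positivity,
      halg.mul (h3.add halg).inv, (h3.add (h2.mul halg)).mul (h2.add (h2.mul halg)).inv,
      by positivity, ne_of_gt (lt_of_lt_of_le (by norm_num) (by positivity : (0 : ℝ) ≤ _)), ?_, ?_,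
      fun q hq => ne_of_lt ?_⟩
    · rw [← sub_ne_zero, e1]; positivity
    · rw [e1]; field_simp; ring
    · rw [add_sub_assoc, e1]
      obtain ⟨η, hη⟩ : ∃ η, η = 1 / (2 + 2 * c) := ⟨_, rfl⟩
      have hη0 : 0 < η := by rw [hη]; positivity
      have hη1 : η < 1 / 2 := by
        rw [hη]
        exact one_div_lt_one_div_of_lt two_pos (by linarith)
      have hD : (3 + 2 * c) / (2 + 2 * c) = 1 + η := by rw [hη, ← e1]; ring
      have hT : 0 < c / (3 + c) := by positivity
      rw [hD, ← hη]
      nlinarith [mul_pos hη0 hT, mul_lt_mul_of_pos_left (hbound q hq) (pow_pos hη0 2)]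
  rcases lt_or_ge (-1) c with hlt | hle
  · refine ⟨_, _, div_nonneg (by linarith) (by linarith),
      div_nonneg_of_nonpos (by linarith) (by linarith), (h1.add halg).mul (h1.sub halg).inv,
      (h2.mul halg).mul (halg.sub h1).inv, admissibleParameters_of_sq_ne_one hc hlt.ne'⟩
  · obtain ⟨n, rfl⟩ : ∃ n, c = -n := ⟨-c, by ring⟩
    have hn : 1 ≤ n := by linarith
    have hn' : 0 < n := by linarith
    replace halg : IsAlgebraic ℚ n := by simpa using halg.neg
    have e1 : (1 + 2 * n) / (2 + 2 * n) - 1 = -1 / (2 + 2 * n) := by field_simp; ring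
    refine ⟨n / (1 + n), (1 + 2 * n) / (2 + 2 * n), by positivity, by positivity,
      halg.mul (h1.add halg).inv, (h1.add (h2.mul halg)).mul (h2.add (h2.mul halg)).inv,
      by positivity, ne_of_gt (lt_of_lt_of_le (by norm_num) (by positivity : (0 : ℝ) ≤ _)), ?_, ?_,
      fun q hq => ne_of_lt ?_⟩
    · rw [← sub_ne_zero, e1]; exact div_ne_zero (by norm_num) (by positivity)
    · rw [e1]; field_simp; ring
    · rw [add_sub_assoc, e1]
      obtain ⟨η, hη⟩ : ∃ η, η = 1 / (2 + 2 * n) := ⟨_, rfl⟩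
      have hη0 : 0 < η := by rw [hη]; positivity
      have hD : (1 + 2 * n) / (2 + 2 * n) = (1 + 2 * n) * η := by rw [hη]; ring
      have hT : n / (1 + n) = 2 * n * η := by rw [hη]; field_simp
      have hneg : -1 / (2 + 2 * n) = -η := by rw [hη]; ring
      rw [hD, hT, hneg]
      have hη2 := pow_pos hη0 2
      calc (-η) ^ 2 * (1 + (q : ℝ)⁻¹) = η ^ 2 * (1 + (q : ℝ)⁻¹) := by ring
        _ < η ^ 2 * 2 := mul_lt_mul_of_pos_left (hbound q hq) hη2
        _ ≤ η ^ 2 * ((1 + 2 * n) * (2 * n - 1)) := by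
          refine mul_le_mul_of_nonneg_left ?_ hη2.le
          nlinarith
        _ = _ := by ring

/-! ### Zariski density on the projective line -/

theorem MvPolynomial.IsHomogeneous.eval_smul_eq {σ R : Type*} [CommRing R] {f : MvPolynomial σ R}
    {n : ℕ} (hf : f.IsHomogeneous n) (a : R) (x : σ → R) :
    MvPolynomial.eval (a • x) f = a ^ n * MvPolynomial.eval x f := by
  rw [MvPolynomial.eval_eq, MvPolynomial.eval_eq, Finset.mul_sum]
  refine Finset.sum_congr rfl fun d hd => ?_
  have hdeg : ∑ i ∈ d.support, d i = n := by
    rw [← hf (MvPolynomial.mem_support_iff.mp hd), Finsupp.weight_apply, Finsupp.sum]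
    simp
  simp only [Pi.smul_apply, smul_eq_mul, mul_pow, Finset.prod_mul_distrib,
    Finset.prod_pow_eq_pow_sum, hdeg]
  ring

theorem affinePoint_injective {F : Type*} [Field F] :
    Function.Injective (affinePoint : F → ℙ F (Fin 2 → F)) := by
  intro s t h
  obtain ⟨a, ha⟩ := (Projectivization.mk_eq_mk_iff F _ _ _ _).mp h
  have h0 := congrFun ha 0
  have h1 := congrFun ha 1
  simp only [Pi.smul_apply, Units.smul_def, smul_eq_mul, Matrix.cons_val_zero,
    Matrix.cons_val_one] at h0 h1
  rw [← h0, ← mul_one (a : F), h1, one_mul]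

theorem eq_affinePoint_of_rep_ne_zero {F : Type*} [Field F] {x : ℙ F (Fin 2 → F)}
    (hx : x.rep 1 ≠ 0) : x = affinePoint (x.rep 0 / x.rep 1) := by
  rw [← x.mk_rep, affinePoint, Projectivization.mk_eq_mk_iff]
  refine ⟨Units.mk0 (x.rep 1) hx, ?_⟩
  rw [x.mk_rep]
  ext i
  fin_cases i
  · simp [Units.smul_def, mul_div_cancel₀ _ hx]
  · simp [Units.smul_def]

theorem finite_projectivization_rep_eq_zero (F : Type*) [Field F] :
    {x : ℙ F (Fin 2 → F) | x.rep 1 = 0}.Finite := by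
  refine Set.Subsingleton.finite fun x hx y hy => ?_
  have h0 : ∀ z : ℙ F (Fin 2 → F), z.rep 1 = 0 → z.rep 0 ≠ 0 := fun z hz h => by
    apply z.rep_nonzero
    ext i
    fin_cases i
    exacts [h, hz]
  rw [← x.mk_rep, ← y.mk_rep, Projectivization.mk_eq_mk_iff]
  refine ⟨Units.mk0 (x.rep 0 / y.rep 0) (div_ne_zero (h0 x hx) (h0 y hy)), ?_⟩
  ext i
  fin_cases i
  · simp [Units.smul_def, div_mul_cancel₀ _ (h0 y hy)]
  · have hx1 : x.rep 1 = 0 := hx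
    have hy1 : y.rep 1 = 0 := hy
    simp [hx1, hy1]

/-- A nonzero homogeneous polynomial in two variables has finitely many zeros on the projective
line. -/
theorem finite_projective_zeros {F : Type*} [Field F] [Infinite F] {f : MvPolynomial (Fin 2) F}
    {n : ℕ} (hf : f.IsHomogeneous n) (h0 : f ≠ 0) :
    {x : ℙ F (Fin 2 → F) | MvPolynomial.eval x.rep f = 0}.Finite := by
  let g : F[X] := MvPolynomial.aeval ![Polynomial.X, 1] f
  have hg : ∀ t, g.eval t = MvPolynomial.eval ![t, 1] f := by
    intro t
    have h : ∀ p, Polynomial.eval t (MvPolynomial.aeval ![Polynomial.X, 1] p) =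
        MvPolynomial.eval ![t, 1] p := by
      intro p
      induction p using MvPolynomial.induction_on with
      | C a => simp
      | add p q hp hq => simp [hp, hq]
      | mul_X p i hp =>
        rw [map_mul, map_mul, Polynomial.eval_mul, hp]
        fin_cases i <;> simp
    exact h f
  have hscale : ∀ x : Fin 2 → F, x 1 ≠ 0 →
      MvPolynomial.eval x f = x 1 ^ n * g.eval (x 0 / x 1) := by
    intro x hx
    rw [hg, ← hf.eval_smul_eq]
    congr 2
    ext i
    fin_cases i
    · simp [mul_div_cancel₀ _ hx]
    · simp
  have hg0 : g ≠ 0 := by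
    intro hg0
    apply h0
    -- If the dehomogenisation vanished, `f` would vanish on `F × Fˣ`, a product of infinite sets.
    refine MvPolynomial.funext_set ![Set.univ, {0}ᶜ] (fun i => ?_) fun x hx => ?_
    · fin_cases i
      · exact Set.infinite_univ
      · exact (Set.finite_singleton 0).infinite_compl
    · have hx1 : x 1 ≠ 0 := hx 1 trivial
      rw [hscale x hx1, hg0, map_zero, Polynomial.eval_zero, mul_zero]
  classical
  refine ((finite_projectivization_rep_eq_zero F).union
    (g.roots.toFinset.finite_toSet.image affinePoint)).subset fun x hx => ?_
  by_cases hx1 : x.rep 1 = 0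
  · exact Or.inl hx1
  · refine Or.inr ⟨x.rep 0 / x.rep 1, ?_, (eq_affinePoint_of_rep_ne_zero hx1).symm⟩
    rw [Set.mem_ofPred_eq, hscale _ hx1] at hx
    simpa [hg0, hx1] using hx

/-- Being empty or cofinite passes from the generating sets to all open sets, and an infinite set
meets every cofinite one. -/
theorem zariskiDense_of_infinite {F : Type*} [Field F] [Infinite F] {S : Set (ℙ F (Fin 2 → F))}
    (hS : S.Infinite) : ZariskiDense S := by
  let _ := zariskiTopology F
  have hopen : ∀ U : Set (ℙ F (Fin 2 → F)), IsOpen U → U = ∅ ∨ Uᶜ.Finite := by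
    intro U hU
    induction hU with
    | basic U hU =>
      obtain ⟨n, f, hf, rfl⟩ := hU
      by_cases h0 : f = 0
      · left; simp [h0]
      · right
        convert finite_projective_zeros hf h0 using 1
        ext x
        simp
    | univ => right; simp
    | inter U U' _ _ h h' =>
      rcases h with rfl | h
      · left; simp
      rcases h' with rfl | h'
      · left; simp
      right
      rw [Set.compl_inter]
      exact h.union h'
    | sUnion A _ h =>
      by_cases hA : ∃ U ∈ A, Uᶜ.Finite
      · obtain ⟨U, hU, hfin⟩ := hA
        exact Or.inr (hfin.subset (Set.compl_subset_compl.mpr (Set.subset_sUnion_of_mem hU)))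
      · left
        push Not at hA
        exact Set.sUnion_eq_empty.mpr fun U hU => (h U hU).resolve_right (hA U hU)
  change Dense S
  rw [dense_iff_inter_open]
  intro U hU hne
  obtain ⟨x, hxS, hxU⟩ := hS.exists_notMem_finite ((hopen U hU).resolve_left hne.ne_empty)
  exact ⟨x, by simpa using hxU, hxS⟩

/-! ### Realisation over the algebraic numbers -/

theorem isAlgClosed_qBar : IsAlgClosed QBar :=
  (algebraicClosure.isAlgClosure ℚ ℂ).isAlgClosed

namespace CausalPencil

variable {V : CausalPencil QBar}

theorem coe_tau (V : CausalPencil QBar) : V.toComplex.tau = (V.tau : ℂ) := by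
  simp [tau, toComplex]

theorem coe_delta (V : CausalPencil QBar) : V.toComplex.delta = (V.delta : ℂ) := by
  simp [delta, toComplex]

theorem coe_Delta (V : CausalPencil QBar) : V.toComplex.Delta = (V.Delta : ℂ) := by
  simp [Delta, toComplex]

theorem coe_masterA (V : CausalPencil QBar) : V.toComplex.masterA = (V.masterA : ℂ) := by
  rw [masterA, masterA, coe_tau, coe_Delta]
  push_cast
  rfl

theorem realises_ofTauDelta {E : WeierstrassCurve QBar} [E.IsElliptic] {c τ δ : QBar} (hc : c ≠ 1)
    (h : AdmissibleParameters c (τ ^ 2) (δ ^ 2)) (hj : E.j = 64 * (3 + c) ^ 3 / (1 - c) ^ 2) :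
    Realises (ofTauDelta τ δ) E := by
  have := isAlgClosed_qBar
  obtain ⟨hsm, hratio⟩ := isSmooth_ofTauDelta hc h.D_ne_one h.T_ne_neg_one h.ratio
  have hjm : (ofTauDelta τ δ).jMap = E.j := by rw [hsm.jMap_eq, hratio, hj]
  refine ⟨hsm, hjm, hsm.spectralCurveIso E hjm, fun K _ _ _ W _ v hv => ?_⟩
  have hτ : (ofTauDelta τ δ).toComplex.tau ≠ 0 := by
    rw [coe_tau, tau_ofTauDelta]
    intro h0
    exact h.T_ne_zero (by simp [show τ = 0 from by exact_mod_cast h0])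
  refine producesEulerFactor_of_masterB_or_masterC_ne_zero hv hτ ?_ ?_
  · rw [coe_masterA]
    exact_mod_cast hsm.masterA_ne_zero
  -- Were both zero, the elimination of `t` would give, at `b = 1/2`, the equality excluded by
  -- `master`.
  · by_contra! hBC
    have hq := masterA_sq_mul_eq hτ hBC.1 hBC.2
    rw [coe_masterA, coe_delta, coe_Delta] at hq
    have hq' : (ofTauDelta τ δ).masterA ^ 2 * (1 + (primeNorm v : QBar)⁻¹) =
        2 * (ofTauDelta τ δ).delta ^ 2 *
          ((ofTauDelta τ δ).masterA + 2 * (ofTauDelta τ δ).Delta) := by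
      apply Subtype.coe_injective
      push_cast
      exact hq
    simp only [masterA, tau_ofTauDelta, delta_ofTauDelta, Delta_ofTauDelta] at hq'
    apply h.master _ (one_lt_primeNorm v)
    linear_combination hq'

/-- The given pencil contributes only its `c`: it may itself have `τ = 0` or `ℬ = 𝒞 = 0` at some
prime, so another pencil with the same `c` replaces it. -/
theorem exists_realises (E : WeierstrassCurve QBar) [E.IsElliptic] (hV : V.IsSmooth)
    (hj : V.jMap = E.j) : ∃ V' : CausalPencil QBar, Realises V' E := by
  have := isAlgClosed_qBar
  obtain ⟨T, D, h⟩ := exists_admissibleParameters hV.quarticRatio_ne_one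
  obtain ⟨τ, rfl⟩ := IsAlgClosed.exists_pow_nat_eq T two_pos
  obtain ⟨δ, rfl⟩ := IsAlgClosed.exists_pow_nat_eq D two_pos
  exact ⟨_, realises_ofTauDelta hV.quarticRatio_ne_one h (hj ▸ hV.jMap_eq)⟩

theorem pencil_eq {F : Type*} [Field F] (V : CausalPencil F) (u l : F) :
    V.pencil u l = !![u ^ 2 - 1 - l * u⁻¹ * V.a, -(l * u⁻¹ * V.b);
      l * u⁻¹ * V.b, u ^ 2 + 1 - l * u⁻¹ * V.d] := by
  ext i j
  fin_cases i <;> fin_cases j <;> simp [pencil, systemOp, coupling]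

theorem fundSymm_mul_mul_fundSymm {R : Type*} [CommRing R] (a b c d : R) :
    fundSymm R * !![a, b; c, d] * fundSymm R = !![a, -b; -c, d] := by
  simp [fundSymm]

open ComplexConjugate in
-- The adjoint exchanges `b` and `-b`, and conjugation by `J` restores the signs, so the condition
-- is invariance under complex conjugation of the entries; the point `u = λ = 1` already detects it.
theorem isJSelfAdjoint_iff : V.IsJSelfAdjoint ↔
    conj (V.a : ℂ) = V.a ∧ conj (V.b : ℂ) = V.b ∧ conj (V.d : ℂ) = V.d := by
  have hadj : ∀ a b c d : ℂ, !![a, b; c, d]ᴴ = !![conj a, conj c; conj b, conj d] := by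
    intro a b c d
    ext i j
    fin_cases i <;> fin_cases j <;> rfl
  simp only [IsJSelfAdjoint, pencil_eq, hadj, fundSymm_mul_mul_fundSymm, toComplex]
  constructor
  · intro h
    have h1 := h 1 1 one_ne_zero
    have h00 := congrFun (congrFun h1 0) 0
    have h10 := congrFun (congrFun h1 1) 0
    have h11 := congrFun (congrFun h1 1) 1
    simp at h00 h10 h11
    exact ⟨h00, h10, h11⟩
  · rintro ⟨ha, hb, hd⟩ u l _
    simp [ha, hb, hd]

/-- The algebraic number given by a real algebraic number. -/
noncomputable def qBarOfReal (x : ℝ) (hx : IsAlgebraic ℚ x) : QBar :=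
  ⟨x, mem_algebraicClosure_iff.mpr (hx.algebraMap (A := ℂ))⟩

theorem exists_isJSelfAdjoint_admissibleParameters {c : QBar} {r : ℝ} (hc : c ≠ 1)
    (hr : (c : ℂ) = r) : ∃ τ δ : QBar, AdmissibleParameters c (τ ^ 2) (δ ^ 2) ∧
      (ofTauDelta τ δ).IsJSelfAdjoint := by
  have hr1 : r ≠ 1 := by
    rintro rfl
    exact hc (Subtype.coe_injective (by simpa using hr))
  have halg : IsAlgebraic ℚ r := by
    have h : IsAlgebraic ℚ (algebraMap ℝ ℂ r) := by
      have := mem_algebraicClosure_iff.mp c.2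
      rwa [hr] at this
    exact (isAlgebraic_algebraMap_iff (algebraMap ℝ ℂ).injective).mp h
  obtain ⟨T, D, hT, hD, hTalg, hDalg, h⟩ := exists_nonneg_admissibleParameters hr1 halg
  have hsqrt : ∀ x : ℝ, 0 ≤ x → IsAlgebraic ℚ x → IsAlgebraic ℚ √x := fun x hx hx' =>
    IsAlgebraic.of_pow two_pos (by rwa [Real.sq_sqrt hx])
  refine ⟨qBarOfReal √T (hsqrt T hT hTalg), qBarOfReal √D (hsqrt D hD hDalg), ?_, ?_⟩
  -- `c` lies in `QBar` but `T`, `D` were found in `ℝ`; the two are compared in `ℂ`.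
  · rw [← admissibleParameters_map_iff (algebraMap QBar ℂ)]
    rw [← admissibleParameters_map_iff Complex.ofRealHom] at h
    convert h using 1
    · exact hr
    · rw [map_pow]
      change ((√T : ℝ) : ℂ) ^ 2 = T
      rw [← Complex.ofReal_pow, Real.sq_sqrt hT]
    · rw [map_pow]
      change ((√D : ℝ) : ℂ) ^ 2 = D
      rw [← Complex.ofReal_pow, Real.sq_sqrt hD]
  · rw [isJSelfAdjoint_iff]
    have h2 : ((2 : QBar) : ℂ) = 2 := rfl
    simp only [ofTauDelta, qBarOfReal]
    push_cast
    have hconj : (starRingEnd ℂ) 2 = 2 := map_ofNat _ 2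
    simp [h2, hconj]

theorem exists_isJSelfAdjoint_realises (E : WeierstrassCurve QBar) [E.IsElliptic]
    (hV : V.IsSmooth) (hJ : V.IsJSelfAdjoint) (hj : V.jMap = E.j) :
    ∃ V' : CausalPencil QBar, V'.IsJSelfAdjoint ∧ Realises V' E := by
  -- `c` is a rational expression in the real entries.
  obtain ⟨r, hr⟩ : ∃ r : ℝ, (V.quarticRatio : ℂ) = r := by
    obtain ⟨ha, hb, hd⟩ := isJSelfAdjoint_iff.mp hJ
    have h4 : ((4 : QBar) : ℂ) = 4 := rfl
    rw [← Complex.conj_eq_iff_real]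
    simp only [quarticRatio, tau, delta, Delta]
    push_cast
    simp only [h4, map_div₀, map_mul, map_add, map_sub, map_pow, ha, hb, hd, map_ofNat]
  obtain ⟨τ, δ, h, hJ'⟩ := exists_isJSelfAdjoint_admissibleParameters hV.quarticRatio_ne_one hr
  exact ⟨_, hJ', realises_ofTauDelta hV.quarticRatio_ne_one h (hj ▸ hV.jMap_eq)⟩

theorem infinite_jImage_isJSelfAdjoint :
    (jImage {V : CausalPencil QBar | V.IsJSelfAdjoint}).Infinite := by
  -- With `p = c - 1`, `j = 64 (p + 4)³ / p²` decreases on `0 < p < 8` and increases afterwards; the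
  -- shift by `10` keeps `p ≥ 9`, where `j` is injective.
  let c : ℕ → QBar := fun n => ((n + 10 : ℕ) : QBar)
  have hc : ∀ n, c n ≠ 1 := fun n h => by
    have : n + 10 = 1 := Nat.cast_injective (h.trans Nat.cast_one.symm)
    omega
  refine Set.infinite_of_injective_forall_mem
    (f := fun n => affinePoint (64 * (3 + c n) ^ 3 / (1 - c n) ^ 2)) (fun m n h => ?_) fun n => ?_
  · have h' := affinePoint_injective h
    rw [div_eq_div_iff (pow_ne_zero 2 (sub_ne_zero.mpr (hc m).symm))
      (pow_ne_zero 2 (sub_ne_zero.mpr (hc n).symm))] at h'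
    have hZ : (64 : ℤ) * (3 + (m + 10)) ^ 3 * (1 - (n + 10)) ^ 2 =
        64 * (3 + (n + 10)) ^ 3 * (1 - (m + 10)) ^ 2 := by
      simp only [c] at h'
      push_cast at h'
      exact_mod_cast h'
    obtain ⟨p, hp⟩ : ∃ p : ℤ, p = m + 9 := ⟨_, rfl⟩
    obtain ⟨q, hq⟩ : ∃ q : ℤ, q = n + 9 := ⟨_, rfl⟩
    have hfac : (p - q) * (p * q * (p * q) - 48 * (p * q) - 64 * (p + q)) = 0 := by
      rw [hp, hq]
      apply mul_left_cancel₀ (show (64 : ℤ) ≠ 0 by norm_num)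
      linear_combination hZ
    have hp9 : 9 ≤ p := by omega
    have hq9 : 9 ≤ q := by omega
    have hpos : 0 < p * q * (p * q) - 48 * (p * q) - 64 * (p + q) := by
      have h81 : 81 ≤ p * q := by nlinarith
      nlinarith
    have := (mul_eq_zero.mp hfac).resolve_right hpos.ne'
    omega
  · obtain ⟨τ, δ, h, hJ⟩ := exists_isJSelfAdjoint_admissibleParameters (r := ((n + 10 : ℕ) : ℝ))
      (hc n) (map_natCast (algebraMap QBar ℂ) _ |>.trans (by simp))
    obtain ⟨hsm, hratio⟩ := isSmooth_ofTauDelta (hc n) h.D_ne_one h.T_ne_neg_one h.ratio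
    exact ⟨_, hJ, hsm, by rw [hsm.jMap_eq, hratio]⟩

end CausalPencil

theorem mainTheorem3 :
    (ZariskiDense (jImage (Set.univ : Set (CausalPencil QBar))) ∧
      ∀ (E : WeierstrassCurve QBar) [E.IsElliptic],
        affinePoint E.j ∈ jImage (Set.univ : Set (CausalPencil QBar)) →
          ∃ V : CausalPencil QBar, Realises V E) ∧
    (ZariskiDense (jImage {V : CausalPencil QBar | V.IsJSelfAdjoint}) ∧
      ∀ (E : WeierstrassCurve QBar) [E.IsElliptic],
        affinePoint E.j ∈ jImage {V : CausalPencil QBar | V.IsJSelfAdjoint} →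
          ∃ V : CausalPencil QBar, V.IsJSelfAdjoint ∧ Realises V E) := by
  have hinf := CausalPencil.infinite_jImage_isJSelfAdjoint
  refine ⟨⟨zariskiDense_of_infinite (hinf.mono ?_), ?_⟩, zariskiDense_of_infinite hinf, ?_⟩
  · rintro x ⟨V, _, hV⟩
    exact ⟨V, trivial, hV⟩
  · rintro E _ ⟨V, _, hV, hj⟩
    exact CausalPencil.exists_realises E hV (affinePoint_injective hj).symm
  · rintro E _ ⟨V, hJ, hV, hj⟩
    exact CausalPencil.exists_isJSelfAdjoint_realises E hV hJ (affinePoint_injective hj).symm
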